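/- Let $(a_n)_{n\ge 0}$, $(b_n)_{n\ge 0}$, $(c_n)_{n\ge 1}$ be real sequences with $a_n\neq 0$ for all $n\ge 0$ and $a_{n-1}c_n>0$ for all $n\ge 1$, and let $(p_n)_{n\ge 0}$ be the real polynomials determined by $p_{-1}=0$, $p_0=1$ and $$x\,p_n(x)=a_n\,p_{n+1}(x)+b_n\,p_n(x)+c_n\,p_{n-1}(x)\qquad (n\ge 0).$$ Let $(\alpha_n)_{n\ge 0}$ be nonzero real numbers with $\alpha_0=1$, and for $N\ge 0$ put $$q_N(x;t)=\sum_{n=0}^{N}t^n\,\alpha_n\,p_n(x).$$ An orthogonality measure for $(p_n)$ is a positive Borel measure $\mu$ on $\mathbb R$ with finite moments of all orders such that $\int p_m p_n\,d\mu=0$ for $m\ne n$ and $\int p_n^2\,d\mu>0$ for all $n$. Then for every $N\ge 0$ there is a $T>0$ (depending only on $N$ and the sequences) such that for all $t>T$ all complex zeros of $x\mapsto q_N(x;t)$ are real and simple, and they are contained in the convex hull of the support $\operatorname{supp}(\mu)\subset\mathbb R$ of every orthogonality measure $\mu$ for $(p_n)$. -/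

import Mathlib

open Polynomial MeasureTheory

noncomputable section

/-- The polynomials determined by `p_{-1} = 0`, `p_0 = 1` and the three-term recurrence
`x p_n = a_n p_{n+1} + b_n p_n + c_n p_{n-1}`, solved for `p_{n+1}` (meant for `a_n ≠ 0`;
the number `c_0` is never used). -/
def recPoly (a b c : ℕ → ℝ) : ℕ → ℝ[X]
  | 0 => 1
  | 1 => C (a 0)⁻¹ * (X - C (b 0))
  | n + 2 => C (a (n + 1))⁻¹ *
      ((X - C (b (n + 1))) * recPoly a b c (n + 1) - C (c (n + 1)) * recPoly a b c n)

theorem recPoly_recurrence_zero (a b c : ℕ → ℝ) (ha : ∀ n, a n ≠ 0) :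
    X * recPoly a b c 0 = C (a 0) * recPoly a b c 1 + C (b 0) * recPoly a b c 0 := by
  have h : (C (a 0) : ℝ[X]) * C (a 0)⁻¹ = 1 := by
    rw [← C_mul, mul_inv_cancel₀ (ha 0), C_1]
  simp only [recPoly]
  linear_combination (-(X - C (b 0))) * h

theorem recPoly_recurrence_succ (a b c : ℕ → ℝ) (ha : ∀ n, a n ≠ 0) (n : ℕ) :
    X * recPoly a b c (n + 1) = C (a (n + 1)) * recPoly a b c (n + 2) +
      C (b (n + 1)) * recPoly a b c (n + 1) + C (c (n + 1)) * recPoly a b c n := by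
  have h : (C (a (n + 1)) : ℝ[X]) * C (a (n + 1))⁻¹ = 1 := by
    rw [← C_mul, mul_inv_cancel₀ (ha (n + 1)), C_1]
  rw [recPoly]
  linear_combination (-((X - C (b (n + 1))) * recPoly a b c (n + 1)
    - C (c (n + 1)) * recPoly a b c n)) * h

/-- The partial sum `q_m(x;t) = ∑_{n=0}^m t^n α_n p_n(x)`, as a polynomial in `x`. -/
def partialGenSum (α : ℕ → ℝ) (p : ℕ → ℝ[X]) (m : ℕ) (t : ℝ) : ℝ[X] :=
  ∑ n ∈ Finset.range (m + 1), C (t ^ n * α n) * p n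

/-- `μ` is an orthogonality measure on the real line for the polynomials `p_n`: all moments
are finite, and the `p_n` are pairwise orthogonal with positive squared norms in `L²(μ)`. -/
structure IsOrthogonalityMeasure (μ : Measure ℝ) (p : ℕ → ℝ[X]) : Prop where
  integrable_pow : ∀ n : ℕ, Integrable (fun x : ℝ => x ^ n) μ
  orthogonal : ∀ m n : ℕ, m ≠ n → ∫ x, (p m).eval x * (p n).eval x ∂μ = 0
  norm_pos : ∀ n : ℕ, 0 < ∫ x, (p n).eval x ^ 2 ∂μ

end

open Filter Topology

/-! Let `y 0 > ⋯ > y N` be the zeros of `p_{N+1}`. Along them `p_N` alternates in sign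
(`exists_roots_alternating`). At these finitely many points the term `t^N α_N p_N` dominates `q_N`
for large `t` (`eventually_pos_sum_range_mul_pow`), so `q_N` alternates too. Having degree at most
`N`, it then has exactly one zero in each of the `N` gaps and no others (`roots_of_alternating`).
The points `y i` are chosen before any measure. Each lies in the convex hull of every support
(`mem_convexHull_support`), hence so do the gaps, and `T` is independent of `μ`. -/

theorem strictAnti_below_of_succ_lt {y : ℕ → ℝ} {n : ℕ} (hy : ∀ i < n, y (i + 1) < y i)
    {i j : ℕ} (hij : i < j) (hj : j ≤ n) : y j < y i := by
  induction j, hij using Nat.le_induction with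
  | base => exact hy i (by omega)
  | succ k hk ih => exact (hy k (by omega)).trans (ih (by omega))

theorem Polynomial.exists_root_Ioo_of_mul_neg (f : ℝ[X]) {u v : ℝ} (huv : u < v)
    (h : f.eval u * f.eval v < 0) : ∃ z, u < z ∧ z < v ∧ f.IsRoot z := by
  rcases mul_neg_iff.1 h with h | h
  · obtain ⟨z, hz, hz'⟩ := intermediate_value_Ioo' huv.le f.continuous.continuousOn ⟨h.2, h.1⟩
    exact ⟨z, hz.1, hz.2, hz'⟩
  · obtain ⟨z, hz, hz'⟩ := intermediate_value_Ioo huv.le f.continuous.continuousOn ⟨h.1, h.2⟩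
    exact ⟨z, hz.1, hz.2, hz'⟩

/-- A polynomial of degree at most `N` that alternates in sign along `y 0 > y 1 > ⋯ > y N` has
exactly one root in each gap, and no other roots. -/
theorem Polynomial.roots_of_alternating {N : ℕ} {f : ℝ[X]} (hdeg : f.natDegree ≤ N) {y : ℕ → ℝ}
    (hy : ∀ i < N, y (i + 1) < y i) {s : ℝ}
    (hs : ∀ i ≤ N, 0 < (-1) ^ i * (s * f.eval (y i))) :
    f.natDegree = N ∧ ∃ z : ℕ → ℝ, (∀ i < N, y (i + 1) < z i ∧ z i < y i) ∧
      f.roots.Nodup ∧ f.roots = (Multiset.range N).map z := by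
  have hf : f ≠ 0 := by
    rintro rfl
    simpa using hs 0 (Nat.zero_le _)
  have hex : ∀ i, ∃ z, i < N → y (i + 1) < z ∧ z < y i ∧ f.IsRoot z := by
    intro i
    by_cases hi : i < N
    · have h1 := mul_pos (hs i hi.le) (hs (i + 1) hi)
      have h2 : ((-1 : ℝ) ^ i) * (-1) ^ i = 1 := by rw [← mul_pow]; simp
      have h3 : (-1) ^ i * (s * f.eval (y i)) * ((-1) ^ (i + 1) * (s * f.eval (y (i + 1))))
          = -(s ^ 2 * (f.eval (y (i + 1)) * f.eval (y i))) := by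
        rw [pow_succ]
        linear_combination (-(s ^ 2 * (f.eval (y (i + 1)) * f.eval (y i)))) * h2
      rw [h3, neg_pos] at h1
      have h4 : f.eval (y (i + 1)) * f.eval (y i) < 0 := by
        by_contra! h
        exact absurd h1 (not_lt.2 (mul_nonneg (sq_nonneg s) h))
      obtain ⟨z, hz⟩ := f.exists_root_Ioo_of_mul_neg (hy i hi) h4
      exact ⟨z, fun _ => hz⟩
    · exact ⟨0, fun h => absurd h hi⟩
  choose z hz using hex
  have hz' : ∀ i < N - 1, z (i + 1) < z i := fun i hi =>
    (hz (i + 1) (by omega)).2.1.trans (hz i (by omega)).1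
  have hnodup : ((Multiset.range N).map z).Nodup := by
    refine (Multiset.nodup_range N).map_on fun i hi j hj hij => ?_
    rw [Multiset.mem_range] at hi hj
    rcases lt_trichotomy i j with h | h | h
    · exact absurd hij (strictAnti_below_of_succ_lt hz' h (by omega)).ne'
    · exact h
    · exact absurd hij (strictAnti_below_of_succ_lt hz' h (by omega)).ne
  have hle : (Multiset.range N).map z ≤ f.roots := by
    rw [Multiset.le_iff_subset hnodup]
    intro w hw
    obtain ⟨i, hi, rfl⟩ := Multiset.mem_map.1 hw
    exact (mem_roots hf).2 (hz i (Multiset.mem_range.1 hi)).2.2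
  have hcard := Multiset.card_le_card hle
  rw [Multiset.card_map, Multiset.card_range] at hcard
  have hcard' := f.card_roots'
  have heq := Multiset.eq_of_le_of_card_le hle (by
    rw [Multiset.card_map, Multiset.card_range]; omega)
  exact ⟨by omega, z, fun i hi => ⟨(hz i hi).1, (hz i hi).2.1⟩, heq ▸ hnodup, heq.symm⟩

/-- If a real polynomial has as many distinct real roots as its degree, then all its complex
roots are real and simple. -/
theorem Polynomial.complex_root_real_simple {f : ℝ[X]} (hf : f ≠ 0) (hnodup : f.roots.Nodup)
    (hcard : Multiset.card f.roots = f.natDegree) {z : ℂ} (hz : aeval z f = 0) :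
    ∃ x : ℝ, (x : ℂ) = z ∧ f.rootMultiplicity x = 1 := by
  rw [← C_leadingCoeff_mul_prod_multiset_X_sub_C hcard, map_mul, aeval_C, map_multiset_prod,
    mul_eq_zero, Multiset.prod_eq_zero_iff] at hz
  rcases hz with hz | hz
  · simp [hf] at hz
  · simp only [Multiset.map_map, Multiset.mem_map] at hz
    obtain ⟨x, hx, hxz⟩ := hz
    refine ⟨x, ?_, ?_⟩
    · simpa [sub_eq_zero, eq_comm] using hxz
    · rw [← count_roots]
      exact Multiset.count_eq_one_of_mem hnodup hx

theorem Polynomial.Monic.exists_gt_eval_pos {f : ℝ[X]} (hf : f.Monic) (hdeg : 0 < f.natDegree)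
    (A : ℝ) : ∃ M, A < M ∧ 0 < f.eval M := by
  have h := f.tendsto_atTop_of_leadingCoeff_nonneg (natDegree_pos_iff_degree_pos.1 hdeg)
    (by rw [hf.leadingCoeff]; exact zero_le_one)
  exact ((eventually_gt_atTop A).and (h.eventually_gt_atTop 0)).exists

theorem Polynomial.Monic.exists_lt_eval_pos {f : ℝ[X]} (hf : f.Monic) (hdeg : 0 < f.natDegree)
    (A : ℝ) : ∃ M, M < A ∧ 0 < (-1) ^ f.natDegree * f.eval M := by
  -- Reflection `x ↦ -x` reduces this to behaviour at `+∞`.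
  obtain ⟨M, hM, hpos⟩ := hf.neg_one_pow_natDegree_mul_comp_neg_X.exists_gt_eval_pos
    (by rw [← C_1, ← C_neg, ← C_pow, natDegree_C_mul (by simp), natDegree_comp]; simpa using hdeg)
    (-A)
  exact ⟨-M, by linarith, by simpa using hpos⟩

/-! ### Interlacing of zeros from the three-term recurrence -/

section MonicRecurrence

variable {P : ℕ → ℝ[X]} {b l : ℕ → ℝ}

theorem monic_of_recurrence (h0 : P 0 = 1) (h1 : P 1 = X - C (b 0))
    (h2 : ∀ n, P (n + 2) = (X - C (b (n + 1))) * P (n + 1) - C (l n) * P n) (n : ℕ) :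
    ((P n).Monic ∧ (P n).natDegree = n) ∧ (P (n + 1)).Monic ∧ (P (n + 1)).natDegree = n + 1 := by
  induction n with
  | zero => simp [h0, h1, monic_X_sub_C]
  | succ n ih =>
    refine ⟨ih.2, ?_⟩
    have hm : ((X - C (b (n + 1))) * P (n + 1)).Monic := (monic_X_sub_C _).mul ih.2.1
    have hd : ((X - C (b (n + 1))) * P (n + 1)).natDegree = n + 2 := by
      rw [(monic_X_sub_C _).natDegree_mul ih.2.1, ih.2.2, natDegree_X_sub_C]; omega
    have hlt : (C (l n) * P n).natDegree < ((X - C (b (n + 1))) * P (n + 1)).natDegree :=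
      (natDegree_C_mul_le _ _).trans_lt (by rw [hd, ih.1.2]; omega)
    rw [h2]
    exact ⟨hm.sub_of_left (degree_lt_degree hlt),
      (natDegree_sub_eq_left_of_natDegree_lt hlt).trans hd⟩

/-- The zeros of `P (n + 1)` are real and simple, and `P n` alternates in sign along them. -/
theorem exists_roots_alternating (h0 : P 0 = 1) (h1 : P 1 = X - C (b 0))
    (h2 : ∀ n, P (n + 2) = (X - C (b (n + 1))) * P (n + 1) - C (l n) * P n)
    (hl : ∀ n, 0 < l n) (n : ℕ) :
    ∃ y : ℕ → ℝ, (∀ i < n, y (i + 1) < y i) ∧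
      P (n + 1) = ∏ j ∈ Finset.range (n + 1), (X - C (y j)) ∧
      ∀ i ≤ n, 0 < (-1) ^ i * (P n).eval (y i) := by
  induction n with
  | zero => exact ⟨fun _ => b 0, by simp, by simp [h1], by simp [h0]⟩
  | succ n ih =>
    obtain ⟨y, hy, hprod, hsign⟩ := ih
    obtain ⟨-, hmon, hdeg⟩ := monic_of_recurrence h0 h1 h2 (n + 1)
    obtain ⟨M, hM, hMpos⟩ := hmon.exists_gt_eval_pos (by omega) (y 0)
    obtain ⟨m, hm, hmpos⟩ := hmon.exists_lt_eval_pos (by omega) (y n)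
    rw [hdeg] at hmpos
    -- The zeros of `P (n + 1)`, shifted by one index and flanked by far points `M` and `m` where
    -- the leading term fixes the sign.
    let w : ℕ → ℝ := fun i => if i = 0 then M else if i ≤ n + 1 then y (i - 1) else m
    have hw0 : w 0 = M := rfl
    have hwy : ∀ i ≤ n, w (i + 1) = y i := fun i hi => by simp [w, hi]
    have hwm : w (n + 2) = m := by simp [w]
    have hw : ∀ i < n + 2, w (i + 1) < w i := by
      intro i hi
      rcases Nat.eq_zero_or_pos i with rfl | hi0
      · rw [hwy 0 (by omega), hw0]; exact hM
      · obtain ⟨k, rfl⟩ := Nat.exists_eq_succ_of_ne_zero hi0.ne'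
        rw [Nat.succ_eq_add_one, hwy k (by omega)]
        rcases Nat.lt_or_ge k n with hk | hk
        · rw [hwy (k + 1) hk]; exact hy k hk
        · obtain rfl : k = n := by omega
          rw [hwm]; exact hm
    have hws : ∀ i ≤ n + 2, 0 < (-1) ^ i * (1 * (P (n + 2)).eval (w i)) := by
      intro i hi
      rw [one_mul]
      rcases Nat.eq_zero_or_pos i with rfl | hi0
      · rw [hw0]; simpa using hMpos
      · obtain ⟨k, rfl⟩ := Nat.exists_eq_succ_of_ne_zero hi0.ne'
        rcases Nat.lt_or_ge n k with hk | hk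
        · obtain rfl : k = n + 1 := by omega
          rw [Nat.succ_eq_add_one, hwm]; exact hmpos
        -- At a zero of `P (n + 1)` the recurrence reduces to `P (n + 2) = -l n * P n`, so
        -- positivity of `l n` transfers the alternation with the opposite sign.
        · have hroot : (P (n + 1)).eval (y k) = 0 := by
            rw [hprod, eval_prod]
            exact Finset.prod_eq_zero (i := k) (Finset.mem_range.2 (by omega)) (by simp)
          rw [Nat.succ_eq_add_one, hwy k hk, h2, eval_sub, eval_mul, hroot, mul_zero, eval_mul,
            eval_C, pow_succ]
          have := mul_pos (hl n) (hsign k hk)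
          linarith
    obtain ⟨-, z, hz, -, hroots⟩ := roots_of_alternating hdeg.le hw hws
    refine ⟨z, fun i hi => (hz (i + 1) (by omega)).2.trans (hz i (by omega)).1, ?_, ?_⟩
    · rw [← prod_multiset_X_sub_C_of_monic_of_roots_card_eq hmon (by rw [hroots, hdeg]; simp),
        hroots, Multiset.map_map]
      rfl
    -- Exactly the `i` zeros `y j` with `j < i` lie above `z i`, so the factorization of `P (n + 1)`
    -- has `i` negative factors there.
    · intro i hi
      rw [hprod, eval_prod, ← Finset.prod_range_mul_prod_Ico _ hi, ← mul_assoc]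
      refine mul_pos ?_ (Finset.prod_pos fun j hj => ?_)
      · have hc : (-1 : ℝ) ^ i = ∏ _j ∈ Finset.range i, (-1 : ℝ) := by simp
        rw [hc, ← Finset.prod_mul_distrib]
        refine Finset.prod_pos fun j hj => ?_
        rw [Finset.mem_range] at hj
        have h3 : z i < w (j + 1) := by
          rcases Nat.lt_or_ge (j + 1) i with h | h
          · exact (hz i (by omega)).2.trans (strictAnti_below_of_succ_lt hw h (by omega))
          · obtain rfl : i = j + 1 := by omega
            exact (hz _ (by omega)).2
        rw [hwy j (by omega)] at h3
        simp only [eval_sub, eval_X, eval_C]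
        linarith
      · rw [Finset.mem_Ico] at hj
        have h3 : w (j + 1) < z i := by
          rcases Nat.lt_or_ge i j with h | h
          · exact (strictAnti_below_of_succ_lt hw (Nat.succ_lt_succ h) (by omega)).trans
              (hz i (by omega)).1
          · obtain rfl : i = j := by omega
            exact (hz _ (by omega)).1
        rw [hwy j (by omega)] at h3
        simp only [eval_sub, eval_X, eval_C]
        linarith

end MonicRecurrence

/-! ### Dominance of the top power of `t` -/

theorem eventually_pos_sum_range_mul_pow {N : ℕ} {u : ℕ → ℝ} (hu : 0 < u N) :
    ∀ᶠ t : ℝ in atTop, 0 < ∑ n ∈ Finset.range (N + 1), u n * t ^ n := by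
  have h : Tendsto (fun t : ℝ => ∑ n ∈ Finset.range N, u n * (t ^ n / t ^ N)) atTop (𝓝 0) := by
    rw [← Finset.sum_const_zero (s := Finset.range N)]
    refine tendsto_finsetSum _ fun n hn => ?_
    simpa using (tendsto_pow_div_pow_atTop_zero (𝕜 := ℝ) (Finset.mem_range.1 hn)).const_mul (u n)
  filter_upwards [h.eventually (lt_mem_nhds (neg_lt_zero.2 hu)), eventually_gt_atTop 0] with t ht ht0
  have hp : 0 < t ^ N := pow_pos ht0 N
  have : ∑ n ∈ Finset.range (N + 1), u n * t ^ n
      = (∑ n ∈ Finset.range N, u n * (t ^ n / t ^ N) + u N) * t ^ N := by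
    rw [Finset.sum_range_succ, add_mul, Finset.sum_mul]
    congr 1
    exact Finset.sum_congr rfl fun n _ => by field_simp
  rw [this]
  exact mul_pos (by linarith) hp

/-! ### Zeros and the support of the measure -/

namespace IsOrthogonalityMeasure

variable {μ : Measure ℝ} {p : ℕ → ℝ[X]}

theorem integrable_eval (hμ : IsOrthogonalityMeasure μ p) (f : ℝ[X]) :
    Integrable (fun x => f.eval x) μ := by
  simp_rw [eval_eq_sum_range]
  exact integrable_finsetSum _ fun i _ => (hμ.integrable_pow i).const_mul _

theorem integral_eval_mul_eq_zero (hμ : IsOrthogonalityMeasure μ p)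
    (hp : ∀ n, p n ≠ 0 ∧ (p n).natDegree = n) {n : ℕ} {r : ℝ[X]} (hr : r.degree < n) :
    ∫ x, ((p n) * r).eval x ∂μ = 0 := by
  -- With `n` fixed, induct on the degree bound for `r`, removing its top term by a multiple of `p
  -- m`, which is orthogonal to `p n`.
  suffices H : ∀ m ≤ n, ∀ r : ℝ[X], r.degree < m → ∫ x, ((p n) * r).eval x ∂μ = 0 from
    H n le_rfl r hr
  intro m
  induction m with
  | zero =>
    intro _ r hr
    have : r = 0 := by simpa [Nat.WithBot.lt_zero_iff] using hr
    simp [this]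
  | succ m ih =>
    intro hm r hr
    set k := r.coeff m / (p m).leadingCoeff with hk
    have hlead : (p m).coeff m ≠ 0 := by
      have := leadingCoeff_ne_zero.2 (hp m).1
      rwa [leadingCoeff, (hp m).2] at this
    have hr' : (r - C k * p m).degree < m := by
      rw [degree_lt_iff_coeff_zero] at hr ⊢
      intro i hi
      rw [coeff_sub, coeff_C_mul]
      rcases hi.eq_or_lt with rfl | hi
      · rw [hk, leadingCoeff, (hp m).2, div_mul_cancel₀ _ hlead, sub_self]
      · rw [hr i hi, coeff_eq_zero_of_natDegree_lt (by rw [(hp m).2]; exact hi), mul_zero, sub_zero]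
    have hsplit : p n * r = p n * (r - C k * p m) + C k * (p n * p m) := by ring
    have h1 := ih (by omega) _ hr'
    have h2 := hμ.orthogonal n m (by omega)
    simp only [← eval_mul] at h2
    rw [hsplit]
    simp_rw [eval_add]
    rw [integral_add (hμ.integrable_eval _) (hμ.integrable_eval _), h1]
    simp_rw [eval_C_mul]
    rw [integral_const_mul, h2, mul_zero, add_zero]

/-- The real zeros of orthogonal polynomials lie in the convex hull of the support. -/
theorem mem_convexHull_support (hμ : IsOrthogonalityMeasure μ p)
    (hp : ∀ n, p n ≠ 0 ∧ (p n).natDegree = n) {n : ℕ} {y : ℝ} (hy : (p n).IsRoot y) :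
    y ∈ convexHull ℝ μ.support := by
  by_contra hmem
  obtain ⟨r, hr⟩ := dvd_iff_isRoot.2 hy
  have hr0 : r ≠ 0 := by rintro rfl; exact (hp n).1 (by rw [hr, mul_zero])
  have hdeg : r.degree < n := by
    have h := (hp n).2
    rw [hr, natDegree_mul (X_sub_C_ne_zero y) hr0, natDegree_X_sub_C] at h
    rw [degree_eq_natDegree hr0]
    exact_mod_cast (by omega : r.natDegree < n)
  have hint := hμ.integral_eval_mul_eq_zero hp hdeg
  -- The support lies on one side of `y`, so `p n * r = (x - y) r²` has constant sign there; its
  -- integral being zero forces it to vanish almost everywhere.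
  have hside : (∀ x ∈ μ.support, x ≤ y) ∨ ∀ x ∈ μ.support, y ≤ x := by
    by_contra! h
    obtain ⟨⟨v, hv, hyv⟩, u, hu, huy⟩ := h
    exact hmem ((convex_convexHull ℝ _).ordConnected.out (subset_convexHull ℝ _ hu)
      (subset_convexHull ℝ _ hv) ⟨huy.le, hyv.le⟩)
  have hae : ∀ᵐ x ∂μ, x ∈ μ.support := Measure.support_mem_ae
  have hval : ∀ x, ((p n) * r).eval x = (x - y) * r.eval x ^ 2 := fun x => by
    rw [hr]; simp only [eval_mul, eval_sub, eval_X, eval_C]; ring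
  have hzero : ∀ᵐ x ∂μ, ((p n) * r).eval x = 0 := by
    rcases hside with h | h
    · have h' : (0 : ℝ → ℝ) ≤ᵐ[μ] fun x => -((p n) * r).eval x := by
        filter_upwards [hae] with x hx
        rw [hval, Pi.zero_apply]
        nlinarith [h x hx, sq_nonneg (r.eval x)]
      filter_upwards [(integral_eq_zero_iff_of_nonneg_ae h' (hμ.integrable_eval _).neg).1
        (by rw [integral_neg, hint, neg_zero])] with x hx
      exact neg_eq_zero.1 hx
    · have h' : (0 : ℝ → ℝ) ≤ᵐ[μ] fun x => ((p n) * r).eval x := by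
        filter_upwards [hae] with x hx
        rw [hval]
        exact mul_nonneg (sub_nonneg.2 (h x hx)) (sq_nonneg _)
      exact (integral_eq_zero_iff_of_nonneg_ae h' (hμ.integrable_eval _)).1 hint
  have hsq : (fun x => (p n).eval x ^ 2) =ᵐ[μ] 0 := by
    filter_upwards [hzero] with x hx
    have h3 : (p n).eval x = (x - y) * r.eval x := by rw [hr]; simp
    rw [eval_mul] at hx
    rw [Pi.zero_apply, h3]
    rw [h3] at hx
    linear_combination (x - y) * hx
  have := hμ.norm_pos n
  rw [integral_congr_ae hsq] at this
  simp at this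

end IsOrthogonalityMeasure

/-! ### Normalization and conclusion -/

/-- The monic normalization of `recPoly`. -/
noncomputable def monicRecPoly (a b c : ℕ → ℝ) (n : ℕ) : ℝ[X] :=
  C (∏ i ∈ Finset.range n, a i) * recPoly a b c n

section RecPoly

variable {a b c : ℕ → ℝ}

theorem monicRecPoly_zero : monicRecPoly a b c 0 = 1 := by simp [monicRecPoly, recPoly]

theorem monicRecPoly_one (ha : ∀ n, a n ≠ 0) : monicRecPoly a b c 1 = X - C (b 0) := by
  simp only [monicRecPoly, recPoly, Finset.prod_range_one]
  rw [← mul_assoc, ← C_mul, mul_inv_cancel₀ (ha 0), C_1, one_mul]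

theorem monicRecPoly_add_two (ha : ∀ n, a n ≠ 0) (n : ℕ) :
    monicRecPoly a b c (n + 2) = (X - C (b (n + 1))) * monicRecPoly a b c (n + 1) -
      C (a n * c (n + 1)) * monicRecPoly a b c n := by
  have h := recPoly_recurrence_succ a b c ha n
  simp only [monicRecPoly, Finset.prod_range_succ, C_mul]
  linear_combination (-(C (∏ i ∈ Finset.range n, a i) * C (a n))) * h

theorem eval_monicRecPoly (n : ℕ) (x : ℝ) :
    (monicRecPoly a b c n).eval x
      = (∏ i ∈ Finset.range n, a i) * (recPoly a b c n).eval x := by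
  rw [monicRecPoly, eval_C_mul]

theorem recPoly_ne_zero_natDegree (ha : ∀ n, a n ≠ 0) (n : ℕ) :
    recPoly a b c n ≠ 0 ∧ (recPoly a b c n).natDegree = n := by
  obtain ⟨⟨hm, hd⟩, -⟩ := monic_of_recurrence (P := monicRecPoly a b c)
    (l := fun n => a n * c (n + 1)) monicRecPoly_zero (monicRecPoly_one ha)
    (monicRecPoly_add_two ha) n
  refine ⟨fun h => hm.ne_zero (by rw [monicRecPoly, h, mul_zero]), ?_⟩
  rwa [monicRecPoly, natDegree_C_mul (Finset.prod_ne_zero_iff.2 fun i _ => ha i)] at hd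

end RecPoly

theorem natDegree_partialGenSum_le {p : ℕ → ℝ[X]} (hp : ∀ n, (p n).natDegree = n) (α : ℕ → ℝ)
    (N : ℕ) (t : ℝ) : (partialGenSum α p N t).natDegree ≤ N :=
  natDegree_sum_le_of_forall_le _ _ fun n hn => (natDegree_C_mul_le _ _).trans (by
    rw [hp]; exact Nat.lt_succ_iff.1 (Finset.mem_range.1 hn))

theorem eval_partialGenSum (α : ℕ → ℝ) (p : ℕ → ℝ[X]) (N : ℕ) (t x : ℝ) :
    (partialGenSum α p N t).eval x
      = ∑ n ∈ Finset.range (N + 1), t ^ n * α n * (p n).eval x := by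
  simp [partialGenSum, eval_finsetSum]

theorem corollary3p3 (a b c α : ℕ → ℝ)
    (ha : ∀ n, a n ≠ 0)
    (hfav : ∀ n : ℕ, 1 ≤ n → 0 < a (n - 1) * c n)
    (hα : ∀ n, α n ≠ 0) (hα0 : α 0 = 1) (N : ℕ) :
    ∃ T : ℝ, 0 < T ∧ ∀ t : ℝ, T < t →
      -- all complex zeros of `q_N(·;t)` are real and simple
      (∀ z : ℂ, aeval z (partialGenSum α (recPoly a b c) N t) = 0 →
        ∃ x : ℝ, (x : ℂ) = z ∧
          (partialGenSum α (recPoly a b c) N t).rootMultiplicity x = 1) ∧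
      -- and they lie in the convex hull of the support of every orthogonality measure
      (∀ μ : Measure ℝ, IsOrthogonalityMeasure μ (recPoly a b c) →
        ∀ x : ℝ, (partialGenSum α (recPoly a b c) N t).IsRoot x →
          x ∈ convexHull ℝ μ.support) := by
  have hp := recPoly_ne_zero_natDegree (b := b) (c := c) ha
  obtain ⟨y, hy, hprod, hsign⟩ := exists_roots_alternating (P := monicRecPoly a b c)
    (l := fun n => a n * c (n + 1)) monicRecPoly_zero (monicRecPoly_one ha)
    (monicRecPoly_add_two ha) (fun n => hfav (n + 1) (by omega)) N
  set κ := ∏ i ∈ Finset.range N, a i with hκ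
  have hev : ∀ᶠ t : ℝ in atTop, ∀ i ∈ Finset.range (N + 1),
      0 < (-1) ^ i * (κ * α N * (partialGenSum α (recPoly a b c) N t).eval (y i)) := by
    refine (Finset.eventually_all _).2 fun i hi => ?_
    have hi' : i ≤ N := Nat.lt_succ_iff.1 (Finset.mem_range.1 hi)
    have hpos := hsign i hi'
    rw [eval_monicRecPoly, ← hκ] at hpos
    -- The extra factor `κ * α N` makes the top coefficient `α N ^ 2` times the quantity in `hpos`,
    -- whatever the signs of `α N` and the `a i`.
    have := eventually_pos_sum_range_mul_pow (N := N)
      (u := fun n => (-1) ^ i * (κ * α N * (α n * (recPoly a b c n).eval (y i))))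
      (by
        have := mul_pos (pow_pos (abs_pos.2 (hα N)) 2) hpos
        rw [sq_abs] at this
        linarith)
    filter_upwards [this] with t ht
    refine ht.trans_eq ?_
    rw [eval_partialGenSum, Finset.mul_sum, Finset.mul_sum]
    exact Finset.sum_congr rfl fun n _ => by ring
  obtain ⟨T, hT⟩ := eventually_atTop.1 hev
  refine ⟨max T 1, lt_max_of_lt_right one_pos, fun t ht => ?_⟩
  have halt := hT t ((le_max_left _ _).trans ht.le)
  obtain ⟨hdeg, z, hz, hnodup, hroots⟩ := roots_of_alternating
    (natDegree_partialGenSum_le (fun n => (hp n).2) α N t) hy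
    (fun i hi => halt i (Finset.mem_range.2 (by omega)))
  have hq : partialGenSum α (recPoly a b c) N t ≠ 0 := by
    intro h
    have := halt 0 (Finset.mem_range.2 (by omega))
    simp [h] at this
  refine ⟨fun w hw => complex_root_real_simple hq hnodup (by rw [hroots, hdeg]; simp) hw,
    fun μ hμ x hx => ?_⟩
  have hmem : ∀ i ≤ N, y i ∈ convexHull ℝ μ.support := fun i hi => by
    refine hμ.mem_convexHull_support hp (n := N + 1) ?_
    have h : (monicRecPoly a b c (N + 1)).eval (y i) = 0 := by
      rw [hprod, eval_prod]
      exact Finset.prod_eq_zero (i := i) (Finset.mem_range.2 (by omega)) (by simp)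
    rw [eval_monicRecPoly] at h
    exact (mul_eq_zero.1 h).resolve_left (Finset.prod_ne_zero_iff.2 fun i _ => ha i)
  have hx' : x ∈ (partialGenSum α (recPoly a b c) N t).roots := (mem_roots hq).2 hx
  rw [hroots, Multiset.mem_map] at hx'
  obtain ⟨i, hi, rfl⟩ := hx'
  rw [Multiset.mem_range] at hi
  exact (convex_convexHull ℝ _).ordConnected.out (hmem (i + 1) hi) (hmem i hi.le)
    ⟨(hz i hi).1.le, (hz i hi).2.le⟩
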